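/- Let $\mathbb K$ be a field, $n\ge 0$, and let $I$ be an ideal of $\mathbb K[x_1,\dots,x_n]$. A monomial ordering is a well-ordering $<$ of the set of monomials $x_1^{i_1}\cdots x_n^{i_n}$ (identified with $\mathbb Z_{\ge 0}^n$) such that $a<b$ implies $ca<cb$ for all monomials $a,b,c$. For a monomial ordering and a nonzero polynomial $f$, let $LM(f)$ be the largest monomial occurring in $f$ with nonzero coefficient, and let $LM(I)$ be the ideal generated by all $LM(f)$ with $0\ne f\in I$ (so $LM(0)=0$ for the zero ideal). A subset $G\subseteq I$ is a Gröbner basis of $I$ with respect to the ordering if the monomials $LM(g)$, $0\neq g\in G$, generate the ideal $LM(I)$. Theorem. There exists a finite set $\{f_1,\dots,f_s\}\subseteq I$ which is a Gröbner basis of $I$ with respect to every monomial ordering simultaneously (a universal Gröbner basis of $I$). -/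

import Mathlib

universe u v

namespace UniversalGroebner

/-- The leading monomial of a polynomial `f` with respect to the monomial ordering `m`:
the `m`-largest monomial occurring in `f`, with coefficient `1`.
It is only meaningful for `f ≠ 0`. -/
noncomputable def leadingMonomial {σ : Type*} {K : Type*} [Field K] (m : MonomialOrder σ)
    (f : MvPolynomial σ K) : MvPolynomial σ K :=
  MvPolynomial.monomial (m.degree f) 1

/-- The ideal generated by the leading monomials of the nonzero polynomials in `S`. -/
noncomputable def leadingMonomialIdeal {σ : Type*} {K : Type*} [Field K] (m : MonomialOrder σ)
    (S : Set (MvPolynomial σ K)) : Ideal (MvPolynomial σ K) :=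
  Ideal.span {p | ∃ f ∈ S, f ≠ 0 ∧ p = leadingMonomial m f}

/-- `G` is a Gröbner basis of the ideal `I` with respect to `m`: it is a subset of `I`, and the
leading monomials of its nonzero elements generate the ideal of leading monomials of `I`. -/
def IsGroebnerBasis {σ : Type*} {K : Type*} [Field K] (m : MonomialOrder σ)
    (I : Ideal (MvPolynomial σ K)) (G : Set (MvPolynomial σ K)) : Prop :=
  G ⊆ (I : Set (MvPolynomial σ K)) ∧
    leadingMonomialIdeal m G = leadingMonomialIdeal m (I : Set (MvPolynomial σ K))

end UniversalGroebner

/-! Compactness of the space of monomial orders. If every finite subset of `I` failed for some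
order, an ultrafilter limit `m` of these bad orders would again be a monomial order, well-founded by
Dickson's lemma. A finite Gröbner basis for `m` involves finitely many comparisons of exponents, so
it has the same leading monomials for most bad orders; by `IsGroebnerBasis.of_degree_eq` it is a
Gröbner basis for those too, a contradiction. -/

namespace UniversalGroebner

open MvPolynomial Filter

universe w

variable {σ K : Type*} [Field K]

/-- A linear order that is a monotone image of a well-quasi-order is a well-order. -/
lemma wellFoundedLT_of_monotone {α β : Type*} [Preorder α] [WellQuasiOrderedLE α] [LinearOrder β]
    {φ : α → β} (hφ : Monotone φ) (hsurj : Function.Surjective φ) : WellFoundedLT β := by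
  refine ⟨RelEmbedding.wellFounded_iff_isEmpty.2 ⟨fun s => ?_⟩⟩
  choose t ht using fun k => hsurj (s k)
  obtain ⟨i, j, hij, hle⟩ := wellQuasiOrdered_le (α := α) t
  have h : s i ≤ s j := by simpa [ht] using hφ hle
  exact absurd (s.map_rel_iff.2 hij) (not_lt.2 h)

/-- The limit of a family of monomial orders along an ultrafilter. -/
lemma exists_ultralimit {σ : Type w} [Finite σ] {ι : Type*} (U : Ultrafilter ι)
    (M : ι → MonomialOrder σ) : ∃ m : MonomialOrder.{w, w} σ, ∀ a b : σ →₀ ℕ,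
      m.toSyn a ≤ m.toSyn b ↔ ∀ᶠ i in U, (M i).toSyn a ≤ (M i).toSyn b := by
  classical
  let R (a b : σ →₀ ℕ) : Prop := ∀ᶠ i in U, (M i).toSyn a ≤ (M i).toSyn b
  let lo : LinearOrder (σ →₀ ℕ) :=
    { le := R
      lt := fun a b => R a b ∧ ¬ R b a
      lt_iff_le_not_ge := fun a b => Iff.rfl
      min := fun a b => if R a b then a else b
      max := fun a b => if R a b then b else a
      min_def := fun a b => rfl
      max_def := fun a b => rfl
      le_refl := fun a => Eventually.of_forall fun i => le_rfl
      le_trans := fun a b c hab hbc => by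
        filter_upwards [hab, hbc] with i h₁ h₂ using h₁.trans h₂
      le_antisymm := fun a b hab hba => by
        obtain ⟨i, h₁, h₂⟩ := (hab.and hba).exists
        exact (M i).toSyn.injective (le_antisymm h₁ h₂)
      -- Totality is where an ultrafilter, not just a filter, is needed.
      le_total := fun a b =>
        Ultrafilter.eventually_or.1 (Eventually.of_forall fun i => le_total _ _)
      toDecidableLE := Classical.decRel _ }
  have hmono : @Monotone (σ →₀ ℕ) (σ →₀ ℕ) _ lo.toPreorder id := fun a b hab =>
    Eventually.of_forall fun i => (M i).toSyn_monotone hab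
  have hadd : ∀ a b, R a b → ∀ c, R (a + c) (b + c) := fun a b hab c => by
    filter_upwards [hab] with i hi
    simpa only [map_add] using add_le_add_left hi ((M i).toSyn c)
  refine ⟨{ syn := σ →₀ ℕ
            addCommMonoidSyn := inferInstance
            linearOrderSyn := lo
            isOrderedAddMonoid_syn := ?_
            toSyn := AddEquiv.refl _
            toSyn_monotone := hmono
            wellFoundedLT_syn := ?_ }, fun a b => Iff.rfl⟩
  · refine @IsOrderedAddMonoid.mk _ _ lo.toPreorder hadd fun a b hab c => ?_
    rw [add_comm c, add_comm c]
    exact hadd a b hab c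
  -- Well-foundedness need not pass to the limit; it follows because the limit extends divisibility,
  -- a well-quasi-order.
  · exact @wellFoundedLT_of_monotone _ _ _ _ lo id hmono Function.surjective_id

/-- If the orders `M i` converge to `m`, the leading exponents of `f` eventually agree. -/
lemma eventually_degree_eq {ι : Type*} {U : Ultrafilter ι} {M : ι → MonomialOrder σ}
    {m : MonomialOrder σ}
    (hm : ∀ a b, m.toSyn a ≤ m.toSyn b ↔ ∀ᶠ i in U, (M i).toSyn a ≤ (M i).toSyn b)
    {f : MvPolynomial σ K} (hf : f ≠ 0) : ∀ᶠ i in U, (M i).degree f = m.degree f := by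
  have h : ∀ᶠ i in U, ∀ c ∈ f.support, (M i).toSyn c ≤ (M i).toSyn (m.degree f) :=
    (Finset.eventually_all _).2 fun c hc => (hm _ _).1 (m.le_degree hc)
  filter_upwards [h] with i hi
  exact (M i).toSyn.injective (le_antisymm (hi _ ((M i).degree_mem_support hf))
    ((M i).le_degree (m.degree_mem_support hf)))

/-- In this form membership reduces to divisibility of exponents. -/
lemma leadingMonomialIdeal_eq_span_image (m : MonomialOrder σ) (S : Set (MvPolynomial σ K)) :
    leadingMonomialIdeal m S =
      Ideal.span ((fun d => monomial d (1 : K)) '' {d | ∃ f ∈ S, f ≠ 0 ∧ m.degree f = d}) := by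
  unfold leadingMonomialIdeal leadingMonomial
  congr 1
  ext p
  constructor
  · rintro ⟨f, hf, h0, rfl⟩
    exact ⟨_, ⟨f, hf, h0, rfl⟩, rfl⟩
  · rintro ⟨_, ⟨f, hf, h0, rfl⟩, rfl⟩
    exact ⟨f, hf, h0, rfl⟩

/-- `G ⊆ I` is a Gröbner basis iff each leading monomial of `I` is divisible by one of `G`. -/
lemma isGroebnerBasis_iff {m : MonomialOrder σ} {I : Ideal (MvPolynomial σ K)}
    {G : Set (MvPolynomial σ K)} :
    IsGroebnerBasis m I G ↔ G ⊆ (I : Set (MvPolynomial σ K)) ∧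
      ∀ f ∈ I, f ≠ 0 → ∃ g ∈ G, g ≠ 0 ∧ m.degree g ≤ m.degree f := by
  refine and_congr_right fun hG => ⟨fun h f hf h0 => ?_, fun h => le_antisymm ?_ ?_⟩
  · have hmem : monomial (m.degree f) (1 : K) ∈ leadingMonomialIdeal m G :=
      h ▸ Ideal.subset_span ⟨f, hf, h0, rfl⟩
    rw [leadingMonomialIdeal_eq_span_image, mem_ideal_span_monomial_image] at hmem
    obtain ⟨_, ⟨g, hg, hg0, rfl⟩, hle⟩ := hmem (m.degree f) (by classical simp [coeff_monomial])
    exact ⟨g, hg, hg0, hle⟩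
  · exact Ideal.span_mono fun p ⟨f, hf, hp⟩ => ⟨f, hG hf, hp⟩
  · refine Ideal.span_le.2 ?_
    rintro _ ⟨f, hf, h0, rfl⟩
    obtain ⟨g, hg, hg0, hle⟩ := h f hf h0
    rw [SetLike.mem_coe, leadingMonomialIdeal_eq_span_image, mem_ideal_span_monomial_image]
    intro d hd
    obtain rfl : d = m.degree f := by simpa [leadingMonomial] using support_monomial_subset hd
    exact ⟨_, ⟨g, hg, hg0, rfl⟩, hle⟩

/-- Every ideal has a finite Gröbner basis of nonzero polynomials. -/
lemma exists_finite_isGroebnerBasis [Finite σ] (m : MonomialOrder σ)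
    (I : Ideal (MvPolynomial σ K)) :
    ∃ G : Finset (MvPolynomial σ K), (∀ g ∈ G, g ≠ 0) ∧
      IsGroebnerBasis m I (G : Set (MvPolynomial σ K)) := by
  classical
  obtain ⟨s, hs, hspan⟩ := (Submodule.fg_span_iff_fg_span_finset_subset _).1
    (IsNoetherian.noetherian (leadingMonomialIdeal m (I : Set (MvPolynomial σ K))))
  have hs' : ∀ p ∈ s, ∃ f ∈ I, f ≠ 0 ∧ p = leadingMonomial m f := fun p hp => hs hp
  choose! φ hφI hφ0 hφ using hs'
  refine ⟨s.image φ, fun g hg => ?_, fun g hg => ?_, ?_⟩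
  · obtain ⟨p, hp, rfl⟩ := Finset.mem_image.1 hg
    exact hφ0 _ hp
  · obtain ⟨p, hp, rfl⟩ := Finset.mem_image.1 hg
    exact hφI _ hp
  · refine le_antisymm (Ideal.span_mono ?_) ?_
    · rintro p ⟨f, hf, hp⟩
      obtain ⟨q, hq, rfl⟩ := Finset.mem_image.1 hf
      exact ⟨_, hφI _ hq, hp⟩
    · refine hspan.trans_le (Submodule.span_mono fun p hp => ?_)
      exact ⟨φ p, Finset.mem_image_of_mem φ hp, hφ0 _ hp, hφ _ hp⟩

/-- A Gröbner basis for `m` is one for every `m'` inducing the same leading monomials on it. -/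
lemma IsGroebnerBasis.of_degree_eq {m : MonomialOrder σ} {m' : MonomialOrder σ}
    {I : Ideal (MvPolynomial σ K)} {G : Set (MvPolynomial σ K)} (hG : IsGroebnerBasis m I G) (h0 : ∀ g ∈ G, g ≠ 0)
    (hdeg : ∀ g ∈ G, m'.degree g = m.degree g) : IsGroebnerBasis m' I G := by
  rw [isGroebnerBasis_iff] at hG ⊢
  obtain ⟨hGI, hG⟩ := hG
  refine ⟨hGI, fun f hf hf0 => ?_⟩
  obtain ⟨q, r, hfr, hq, hr⟩ := m'.div_set (B := G)
    (fun g hg => (m'.leadingCoeff_ne_zero_iff.2 (h0 g hg)).isUnit) f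
  rw [Finsupp.linearCombination_apply, Finsupp.sum] at hfr
  have hsum : ∑ b ∈ q.support, q b • (b : MvPolynomial σ K) ∈ I :=
    I.sum_mem fun b _ => I.mul_mem_left _ (hGI b.2)
  have hrI : r ∈ I := (I.add_mem_iff_right hsum).1 (hfr ▸ hf)
  -- No term of `r` is divisible by a leading monomial of `G`, the same for `m` and `m'`; yet if `r
  -- ≠ 0`, its `m`-leading term must be.
  have hr0 : r = 0 := by
    by_contra hr0
    obtain ⟨g, hg, -, hle⟩ := hG r hrI hr0
    exact hr _ (m.degree_mem_support hr0) g hg (by rwa [hdeg g hg])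
  rw [hr0, add_zero] at hfr
  -- The `m'`-leading monomial of `f` survives in some product `q b • b`, whose degree cannot exceed
  -- that of `f`, so it leads there.
  have hc : coeff (m'.degree f) (∑ b ∈ q.support, q b • (b : MvPolynomial σ K)) ≠ 0 := by
    rw [← hfr]
    exact m'.coeff_degree_ne_zero_iff.2 hf0
  rw [coeff_sum] at hc
  obtain ⟨b, -, hb⟩ := Finset.exists_ne_zero_of_sum_ne_zero hc
  rw [smul_eq_mul, mul_comm] at hb
  have hne : (b : MvPolynomial σ K) * q b ≠ 0 := fun h => hb (by rw [h, coeff_zero])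
  have heq : m'.degree f = m'.degree ((b : MvPolynomial σ K) * q b) :=
    m'.toSyn.injective (le_antisymm (m'.le_degree (mem_support_iff.2 hb)) (hq b))
  refine ⟨b, b.2, h0 b b.2, ?_⟩
  rw [heq, m'.degree_mul' hne]
  exact le_self_add

/-- A subset of `I` containing a Gröbner basis is a Gröbner basis. -/
lemma IsGroebnerBasis.mono {m : MonomialOrder σ} {I : Ideal (MvPolynomial σ K)}
    {G H : Set (MvPolynomial σ K)} (hG : IsGroebnerBasis m I G) (hGH : G ⊆ H)
    (hH : H ⊆ (I : Set (MvPolynomial σ K))) : IsGroebnerBasis m I H := by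
  rw [isGroebnerBasis_iff] at hG ⊢
  refine ⟨hH, fun f hf hf0 => ?_⟩
  obtain ⟨g, hg, h⟩ := hG.2 f hf hf0
  exact ⟨g, hGH hg, h⟩

/-- Every ideal in finitely many variables has a finite universal Gröbner basis. Otherwise each
finite `G ⊆ I` fails for some order; a limit of these orders has a finite Gröbner basis, which
is then one for arbitrarily large `G`. -/
lemma exists_universal_groebnerBasis [Finite σ] (I : Ideal (MvPolynomial σ K)) :
    ∃ G : Finset (MvPolynomial σ K), ∀ m : MonomialOrder σ,
      IsGroebnerBasis m I (G : Set (MvPolynomial σ K)) := by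
  classical
  by_contra! hcon
  let T : Finset I → Finset (MvPolynomial σ K) := fun S => S.image Subtype.val
  have hT : ∀ S, (T S : Set (MvPolynomial σ K)) ⊆ I := fun S f hf => by
    obtain ⟨x, -, rfl⟩ := Finset.mem_image.1 hf
    exact x.2
  choose M hM using fun S : Finset I => hcon (T S)
  -- Being finer than `atTop`, `U` makes `S` eventually contain any given finite subset of `I`.
  let U : Ultrafilter (Finset I) := Ultrafilter.of atTop
  obtain ⟨m, hm⟩ := exists_ultralimit U M
  obtain ⟨G, hG0, hG⟩ := exists_finite_isGroebnerBasis m I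
  have hdeg : ∀ᶠ S in U, ∀ g ∈ G, (M S).degree g = m.degree g :=
    (Finset.eventually_all _).2 fun g hg => eventually_degree_eq hm (hG0 g hg)
  have hlarge : ∀ᶠ S in U, G.subtype (· ∈ I) ⊆ S :=
    (Ultrafilter.of_le atTop) (eventually_ge_atTop (G.subtype (· ∈ I)))
  obtain ⟨S, hS, hGS⟩ := (hdeg.and hlarge).exists
  refine hM S ((hG.of_degree_eq hG0 hS).mono (fun g hg => ?_) (hT S))
  exact Finset.mem_image.2 ⟨⟨g, hG.1 hg⟩, hGS (Finset.mem_subtype.2 hg), rfl⟩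

end UniversalGroebner

theorem mainTheorem3 {K : Type u} [Field K] (n : ℕ) (I : Ideal (MvPolynomial (Fin n) K)) :
    ∃ G : Finset (MvPolynomial (Fin n) K), ∀ m : MonomialOrder.{0, v} (Fin n),
      UniversalGroebner.IsGroebnerBasis m I (G : Set (MvPolynomial (Fin n) K)) :=
  UniversalGroebner.exists_universal_groebnerBasis I
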